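/- Let $\mathbb{N}=\{1,2,\dots\}$. For $\delta\in(0,1]$, a sequence $a:\mathbb{N}\to\mathbb{R}$ is called *$\delta$-scattered* if there is $\epsilon>0$ such that for every sufficiently large $N$ $$\frac1{N^2}\sum_{1\le m<n\le N}\min\big(|a(n)-a(m)|^{-\delta},1\big)\le\frac1{(\log N)^{1+\epsilon}},$$ where the minimum is $1$ if $a(n)=a(m)$; it is *scattered* if it is $\delta$-scattered for every $\delta\in(0,1]$. Sequences $a_1,\dots,a_k:\mathbb{N}\to\mathbb{R}$ are *jointly scattered* if $v_1a_1+\cdots+v_ka_k$ is scattered for every non-zero $v\in\mathbb{R}^k$. A sequence $(x_n)_{n\in\mathbb{N}}$ in $\mathbb{R}^k$ is *uniformly distributed in $\mathbb{T}^k$* (or modulo 1) if for all intervals $I_1,\dots,I_k\subset[0,1]$ the proportion of those $n\in\{1,\dots,N\}$ for which the vector of fractional parts of $x_n$ lies in $I_1\times\cdots\times I_k$ tends, as $N\to\infty$, to the Lebesgue measure of $I_1\times\cdots\times I_k$. An *analytic curve* $\gamma\subset\mathbb{R}^k$ is the image of a real analytic function $f:\mathbb{R}\to\mathbb{R}^k$,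 called a parametrization of $\gamma$; it is *non-degenerate* if it is not contained in an affine hyperplane $\{x\in\mathbb{R}^k: c_1x_1+\cdots+c_kx_k=\alpha\}$ with $c\ne0$. **Theorem.** Let $k\in\mathbb{N}$, let $\gamma\subset\mathbb{R}^k$ be an analytic curve and let $a_1,\dots,a_k:\mathbb{N}\to\mathbb{R}$ be scattered. Assume that either 1. $a_1,\dots,a_k$ are jointly scattered and none of the coordinates $x_1,\dots,x_k$ is constant on $\gamma$, or 2. $\gamma$ is non-degenerate. Then for almost every $(x_1,\dots,x_k)\in\gamma$ the sequence $\big(a_1(n)x_1,\dots,a_k(n)x_k\big)_{n\in\mathbb{N}}$ is uniformly distributed in $\mathbb{T}^k$. Here "almost every" holds both with respect to length (one-dimensional Hausdorff measure) on $\gamma$ and in terms of the parameter: for every real analytic parametrization $f=(f_1,\dots,f_k)$ of $\gamma$ and Lebesgue-almost every $t\in\mathbb{R}$, the sequence $\big(a_1(n)f_1(t),\dots,a_k(n)f_k(t)\big)_{n\in\mathbb{N}}$ is uniformly distributed in $\mathbb{T}^k$. -/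

import Mathlib

open Filter Topology MeasureTheory

namespace CurveUD

/-- The quantity `min (|t| ^ (-δ), 1)` for `δ > 0`, with the convention `|0| ^ (-δ) = ∞`, so that
its value at `t = 0` is `1` (Lean's real power would give `0 ^ (-δ) = 0`). -/
noncomputable def truncPow (δ t : ℝ) : ℝ :=
  if t = 0 then 1 else min (|t| ^ (-δ)) 1

/-- `δ`-scattered sequences. Sequences are indexed by the positive integers: the value at `0`
is never used. -/
def IsDeltaScattered (δ : ℝ) (a : ℕ → ℝ) : Prop :=
  ∃ ε : ℝ, 0 < ε ∧ ∀ᶠ N : ℕ in atTop,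
    1 / (N : ℝ) ^ 2 * ∑ n ∈ Finset.Icc 1 N, ∑ m ∈ Finset.Ico 1 n, truncPow δ (a n - a m)
      ≤ 1 / Real.log N ^ (1 + ε)

/-- A sequence is scattered if it is `δ`-scattered for every `δ ∈ (0, 1]`. -/
def IsScattered (a : ℕ → ℝ) : Prop :=
  ∀ δ : ℝ, 0 < δ → δ ≤ 1 → IsDeltaScattered δ a

/-- Sequences `a₁, …, a_k` are jointly scattered if every nontrivial real linear combination of
them is scattered. -/
def JointlyScattered {k : ℕ} (a : Fin k → ℕ → ℝ) : Prop :=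
  ∀ v : Fin k → ℝ, v ≠ 0 → IsScattered (fun n => ∑ i, v i * a i n)

open scoped Classical in
/-- Uniform distribution modulo 1 of a sequence `(x_n)_{n ≥ 1}` in `ℝ^k`: for all intervals
`I₁, …, I_k ⊆ [0, 1]` (of any kind: order-connected sets) the asymptotic frequency of the `n` for
which the vector of fractional parts of `x_n` lies in the box `I₁ × ⋯ × I_k` exists and equals the
Lebesgue measure of the box. -/
def IsUniformlyDistributed {k : ℕ} (x : ℕ → Fin k → ℝ) : Prop :=
  ∀ I : Fin k → Set ℝ, (∀ i, (I i).OrdConnected ∧ I i ⊆ Set.Icc 0 1) →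
    Tendsto
      (fun N : ℕ => 1 / (N : ℝ) *
        (((Finset.Icc 1 N).filter (fun n => ∀ i, Int.fract (x n i) ∈ I i)).card : ℝ))
      atTop (𝓝 (volume (Set.univ.pi I)).toReal)

/-- An analytic parametrization of `γ`: a real analytic `f : ℝ → ℝ^k` with image `γ`. -/
def IsAnalyticParam {k : ℕ} (f : ℝ → EuclideanSpace ℝ (Fin k))
    (γ : Set (EuclideanSpace ℝ (Fin k))) : Prop :=
  AnalyticOnNhd ℝ f Set.univ ∧ Set.range f = γ

/-- An analytic curve in `ℝ^k` is the image of a real analytic function `ℝ → ℝ^k`. -/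
def IsAnalyticCurve {k : ℕ} (γ : Set (EuclideanSpace ℝ (Fin k))) : Prop :=
  ∃ f : ℝ → EuclideanSpace ℝ (Fin k), IsAnalyticParam f γ

/-- `γ` is non-degenerate if it is contained in no (affine) hyperplane
`{x | c₁ x₁ + ⋯ + c_k x_k = α}`, `c ≠ 0`. -/
def NonDegenerate {k : ℕ} (γ : Set (EuclideanSpace ℝ (Fin k))) : Prop :=
  ∀ (c : Fin k → ℝ) (α : ℝ), c ≠ 0 → ¬ γ ⊆ {x | ∑ i, c i * x i = α}

/-- None of the coordinate functions `x₁, …, x_k` is constant on `γ`. -/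
def NoConstantCoordinate {k : ℕ} (γ : Set (EuclideanSpace ℝ (Fin k))) : Prop :=
  ∀ (i : Fin k) (α : ℝ), ¬ γ ⊆ {x | x i = α}

end CurveUD

namespace CurveUD

/-! By Weyl's criterion it suffices that, for each of the countably many frequencies `m ≠ 0`, the
averages of `exp (i ⟪c n, f t⟫)` tend to `0` for almost every `t`, where `c n` has coordinates `2π
m_i a_i(n)`.

Let `V` be the span of the differences `f t - f 0`. Only the projection of `c` to `V` affects the
modulus of `∫ exp (i ⟪c, f t⟫)`. For a unit vector of `V` the phase is analytic and non-constant, so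
some derivative at `t₀` is non-zero. Van der Corput's lemma and compactness of the unit sphere of
`V` give power decay near `t₀`, hence a bound `C * truncPow δ ⟪u, c⟫` for every `u ∈ V`
(`exists_norm_integral_exp_inner_le_truncPow`).

If `⟪u, c n⟫` is scattered, the mean square of the exponential averages is `O((log N)^(-1-ε))`. This
is summable along `N = ⌊c^j⌋`, and the gaps are filled by letting `c → 1`
(`ae_tendsto_average_exp`).

It remains to find `u`. Under joint scattering, a displacement `f t - f 0` moving a coordinate with
`m_i ≠ 0` works; for a non-degenerate curve `V` is everything, and a multiple of a basis vector
isolates one `a_i`. -/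

/-! ### Weyl's criterion on the torus -/

/-- The averages, uniformly in `N`, and the integral are 1-Lipschitz in the sup norm, so an `ε / 3`
argument applies. -/
theorem isClosed_setOf_tendsto_average {Y : Type*} [TopologicalSpace Y] [CompactSpace Y]
    [MeasurableSpace Y] [BorelSpace Y] (p : ℕ → Y) (μ : Measure Y) [IsProbabilityMeasure μ] :
    IsClosed {F : C(Y, ℂ) | Tendsto (fun N : ℕ => (∑ n ∈ Finset.Icc 1 N, F (p n)) / (N : ℂ))
      atTop (𝓝 (∫ y, F y ∂μ))} := by
  refine isClosed_of_closure_subset fun F hF => ?_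
  rw [Metric.mem_closure_iff] at hF
  rw [Set.mem_ofPred_eq, Metric.tendsto_atTop]
  intro ε hε
  obtain ⟨G, hG, hFG⟩ := hF (ε / 3) (by positivity)
  obtain ⟨N₀, hN₀⟩ := Metric.tendsto_atTop.1 hG (ε / 3) (by positivity)
  refine ⟨N₀, fun N hN => ?_⟩
  have hpt : ∀ y, ‖F y - G y‖ ≤ ε / 3 := fun y => by
    rw [← dist_eq_norm]; exact (ContinuousMap.dist_apply_le_dist y).trans hFG.le
  have hint : ∀ H : C(Y, ℂ), Integrable (fun y => H y) μ := fun H =>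
    (integrable_const ‖H‖).mono' H.continuous.aestronglyMeasurable_of_compactSpace
      (Eventually.of_forall H.norm_coe_le_norm)
  have h1 : ‖(∑ n ∈ Finset.Icc 1 N, F (p n)) / (N : ℂ)
      - (∑ n ∈ Finset.Icc 1 N, G (p n)) / (N : ℂ)‖ ≤ ε / 3 := by
    rw [← sub_div, ← Finset.sum_sub_distrib, norm_div, Complex.norm_natCast]
    refine div_le_of_le_mul₀ (by positivity) (by positivity) ?_
    refine (norm_sum_le_of_le _ fun n _ => hpt (p n)).trans ?_
    simp [mul_comm]
  have h2 : ‖(∫ y, G y ∂μ) - ∫ y, F y ∂μ‖ ≤ ε / 3 := by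
    rw [← integral_sub (hint G) (hint F)]
    refine (norm_integral_le_of_norm_le_const
      (Eventually.of_forall fun y => (norm_sub_rev _ _).trans_le (hpt y))).trans ?_
    simp
  have h3 := hN₀ N hN
  rw [dist_eq_norm] at h3 ⊢
  calc _ = ‖((∑ n ∈ Finset.Icc 1 N, F (p n)) / (N : ℂ) - (∑ n ∈ Finset.Icc 1 N, G (p n)) / (N : ℂ))
        + ((∑ n ∈ Finset.Icc 1 N, G (p n)) / (N : ℂ) - ∫ y, G y ∂μ)
        + ((∫ y, G y ∂μ) - ∫ y, F y ∂μ)‖ := by congr 1; ring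
    _ ≤ _ := norm_add₃_le
    _ < ε := by linarith

instance isProbabilityMeasure_volume_unitAddCircle :
    IsProbabilityMeasure (volume : Measure UnitAddCircle) :=
  ⟨UnitAddCircle.measure_univ⟩

instance isProbabilityMeasure_volume_unitAddTorus {k : ℕ} :
    IsProbabilityMeasure (volume : Measure (UnitAddTorus (Fin k))) :=
  inferInstanceAs (IsProbabilityMeasure (Measure.pi fun _ : Fin k => (volume : Measure UnitAddCircle)))

/-- Translation by `1 / (2m)` preserves the measure and negates the character. -/
theorem integral_fourier_eq_zero {m : ℤ} (hm : m ≠ 0) : ∫ y : UnitAddCircle, fourier m y = 0 :=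
  integral_eq_zero_of_add_right_eq_neg (fourier_add_half_inv_index hm one_pos)

theorem integral_mFourier {k : ℕ} (m : Fin k → ℤ) (hm : m ≠ 0) :
    ∫ y : UnitAddTorus (Fin k), UnitAddTorus.mFourier m y = 0 := by
  obtain ⟨i, hi⟩ := Function.ne_iff.1 hm
  simp only [UnitAddTorus.mFourier, ContinuousMap.coe_mk]
  rw [volume_pi]
  rw [integral_fintype_prod_eq_prod (f := fun i (y : UnitAddCircle) => fourier (m i) y)]
  refine Finset.prod_eq_zero (Finset.mem_univ i) ?_
  exact integral_fourier_eq_zero hi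

/-- Trigonometric polynomials are dense, and the functions with the right limit form a closed
subspace. -/
theorem tendsto_average_of_weyl {k : ℕ} (p : ℕ → UnitAddTorus (Fin k))
    (h : ∀ m : Fin k → ℤ, m ≠ 0 → Tendsto (fun N : ℕ =>
      (∑ n ∈ Finset.Icc 1 N, UnitAddTorus.mFourier m (p n)) / (N : ℂ)) atTop (𝓝 0))
    (F : C(UnitAddTorus (Fin k), ℂ)) :
    Tendsto (fun N : ℕ => (∑ n ∈ Finset.Icc 1 N, F (p n)) / (N : ℂ)) atTop (𝓝 (∫ y, F y)) := by
  have hint : ∀ H : C(UnitAddTorus (Fin k), ℂ), Integrable (fun y => H y) := fun H =>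
    (integrable_const ‖H‖).mono' H.continuous.aestronglyMeasurable_of_compactSpace
      (Eventually.of_forall H.norm_coe_le_norm)
  have hF : F ∈ (Submodule.span ℂ (Set.range <| UnitAddTorus.mFourier (d := Fin k))).topologicalClosure := by
    rw [UnitAddTorus.span_mFourier_closure_eq_top]; trivial
  refine closure_minimal (fun G hG => ?_) (isClosed_setOf_tendsto_average p volume) hF
  induction hG using Submodule.span_induction with
  | mem G hG =>
    obtain ⟨m, rfl⟩ := hG
    by_cases hm : m = 0
    · subst hm
      simp only [Set.mem_ofPred_eq, UnitAddTorus.mFourier_zero, ContinuousMap.one_apply]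
      refine Tendsto.congr' (f₁ := fun _ => 1) ?_ (by simp)
      filter_upwards [eventually_ne_atTop 0] with N hN
      simp [hN]
    · simpa [integral_mFourier m hm] using h m hm
  | zero => simp
  | add G H _ _ hG hH =>
    simp only [Set.mem_ofPred_eq, ContinuousMap.add_apply, Finset.sum_add_distrib, add_div] at *
    rw [integral_add (hint G) (hint H)]
    exact hG.add hH
  | smul c G _ hG =>
    simp only [Set.mem_ofPred_eq, ContinuousMap.smul_apply, smul_eq_mul, ← Finset.mul_sum,
      mul_div_assoc] at *
    rw [integral_const_mul]
    exact hG.const_mul c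

/-- The points of the circle `ℝ / ℤ` whose representative in `[0, 1)` lies in `I`. -/
def circleSet (I : Set ℝ) : Set UnitAddCircle :=
  {y | (AddCircle.equivIco 1 0 y : ℝ) ∈ I}

theorem coe_mem_circleSet {I : Set ℝ} {x : ℝ} :
    (x : UnitAddCircle) ∈ circleSet I ↔ Int.fract x ∈ I := by
  simp [circleSet, AddCircle.coe_equivIco_mk_apply]

theorem measurable_coe_equivIco :
    Measurable fun y : UnitAddCircle => (AddCircle.equivIco 1 0 y : ℝ) :=
  measurable_subtype_coe.comp (AddCircle.measurableEquivIco 1 0).measurable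

theorem volume_circleSet {I : Set ℝ} (hI : MeasurableSet I) :
    volume (circleSet I) = volume (I ∩ Set.Icc 0 1) := by
  have hm : MeasurableSet (circleSet I) := measurable_coe_equivIco hI
  rw [← (UnitAddCircle.measurePreserving_mk 0).measure_preimage hm.nullMeasurableSet,
    Measure.restrict_congr_set (Ioo_ae_eq_Ioc (μ := volume)).symm,
    Measure.restrict_apply ((AddCircle.measurable_mk' (a := 1)) hm)]
  have h2 : (I ∩ Set.Icc 0 1 : Set ℝ) =ᵐ[volume] (I ∩ Set.Ioo 0 1 : Set ℝ) :=
    (ae_eq_refl I).inter Ioo_ae_eq_Icc.symm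
  rw [measure_congr h2]
  congr 1
  ext x
  simp only [zero_add, Set.mem_inter_iff, Set.mem_preimage, and_congr_left_iff]
  intro hx
  rw [coe_mem_circleSet, Int.fract_eq_self.2 ⟨hx.1.le, hx.2⟩]

/-- The representative in `[0, 1)` depends continuously on the point away from `0`. -/
theorem frontier_circleSet_subset (I : Set ℝ) :
    frontier (circleSet I) ⊆ {0} ∪ circleSet (frontier I) := by
  intro y hy
  by_contra hcon
  simp only [Set.mem_union, Set.mem_singleton_iff, not_or] at hcon
  obtain ⟨h0, hf⟩ := hcon
  have hc : ContinuousAt (fun y : UnitAddCircle => (AddCircle.equivIco 1 0 y : ℝ)) y :=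
    continuousAt_subtype_val.comp (AddCircle.continuousAt_equivIco 1 0 (by simpa using h0))
  rw [frontier_eq_closure_inter_closure, Set.mem_inter_iff, mem_closure_iff_frequently,
    mem_closure_iff_frequently] at hy
  refine hf ?_
  change _ ∈ frontier I
  rw [frontier_eq_closure_inter_closure, Set.mem_inter_iff, mem_closure_iff_frequently,
    mem_closure_iff_frequently]
  exact ⟨hc.frequently hy.1, hc.frequently hy.2⟩

theorem volume_frontier_circleSet {I : Set ℝ} (hI : I.OrdConnected) :
    volume (frontier (circleSet I)) = 0 := by
  refine measure_mono_null (frontier_circleSet_subset I) (measure_union_null ?_ ?_)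
  · have h : ({0} : Set UnitAddCircle) ⊆ circleSet {0} := by
      rintro _ rfl
      exact (coe_mem_circleSet (x := 0)).2 (by simp)
    refine measure_mono_null h ?_
    rw [volume_circleSet (measurableSet_singleton 0)]
    exact measure_mono_null Set.inter_subset_left (by simp)
  · rw [volume_circleSet measurableSet_frontier]
    exact measure_mono_null Set.inter_subset_left (hI.convex.addHaar_frontier volume)

theorem volume_frontier_univ_pi {k : ℕ} {D : Fin k → Set UnitAddCircle}
    (hD : ∀ i, volume (frontier (D i)) = 0) :
    volume (frontier (Set.univ.pi D) : Set (UnitAddTorus (Fin k))) = 0 := by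
  have hsub : (frontier (Set.univ.pi D) : Set (UnitAddTorus (Fin k))) ⊆
      ⋃ i, Function.eval i ⁻¹' frontier (D i) := by
    intro y hy
    rw [frontier, closure_pi_set, interior_pi_set Set.finite_univ] at hy
    obtain ⟨h1, h2⟩ := hy
    simp only [Set.mem_pi, Set.mem_univ, true_implies, not_forall] at h1 h2
    obtain ⟨i, hi⟩ := h2
    exact Set.mem_iUnion.2 ⟨i, h1 i, hi⟩
  exact measure_mono_null hsub (measure_iUnion_null fun i => Measure.pi_eval_preimage_null _ (hD i))

/-- Portmanteau: the empirical measures converge weakly to Lebesgue measure, and `B` is a continuity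
set. -/
theorem tendsto_card_filter_of_weyl {k : ℕ} (p : ℕ → UnitAddTorus (Fin k))
    (h : ∀ m : Fin k → ℤ, m ≠ 0 → Tendsto (fun N : ℕ =>
      (∑ n ∈ Finset.Icc 1 N, UnitAddTorus.mFourier m (p n)) / (N : ℂ)) atTop (𝓝 0))
    (B : Set (UnitAddTorus (Fin k))) [DecidablePred (· ∈ B)] (hm : MeasurableSet B)
    (hB : volume (frontier B) = 0) :
    Tendsto (fun N : ℕ => 1 / (N : ℝ) * (((Finset.Icc 1 N).filter (p · ∈ B)).card : ℝ))
      atTop (𝓝 (volume B).toReal) := by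
  -- The shift makes every empirical measure a probability measure; `N = 0` would give the zero
  -- measure.
  rw [← tendsto_add_atTop_iff_nat 1]
  set ν : ℕ → Measure (UnitAddTorus (Fin k)) := fun N =>
    ((N + 1 : ℕ) : ENNReal)⁻¹ • ∑ n ∈ Finset.Icc 1 (N + 1), Measure.dirac (p n) with hν
  have hprob : ∀ N, IsProbabilityMeasure (ν N) := fun N => ⟨by
    simp only [hν, Measure.smul_apply, Measure.finsetSum_apply, measure_univ, smul_eq_mul]
    simp only [Finset.sum_const, Nat.card_Icc, Nat.add_sub_cancel, nsmul_eq_mul, mul_one]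
    exact ENNReal.inv_mul_cancel (by simp) (ENNReal.natCast_ne_top _)⟩
  obtain ⟨P, hP⟩ : ∃ P : ℕ → ProbabilityMeasure (UnitAddTorus (Fin k)), ∀ N,
      (P N : Measure (UnitAddTorus (Fin k))) = ν N := ⟨fun N => ⟨ν N, hprob N⟩, fun _ => rfl⟩
  obtain ⟨Q, hQ⟩ : ∃ Q : ProbabilityMeasure (UnitAddTorus (Fin k)),
      (Q : Measure (UnitAddTorus (Fin k))) = volume := ⟨⟨volume, inferInstance⟩, rfl⟩
  have hlim : Tendsto P atTop (𝓝 Q) := by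
    rw [ProbabilityMeasure.tendsto_iff_forall_integral_tendsto]
    intro f
    have h1 := tendsto_average_of_weyl p h ⟨fun y => ((f y : ℝ) : ℂ), by fun_prop⟩
    have h2 := (Complex.continuous_re.tendsto _).comp ((tendsto_add_atTop_iff_nat 1).2 h1)
    convert! h2 using 1
    · ext N
      simp only [hP, hν, integral_smul_measure, Function.comp_apply, ContinuousMap.coe_mk]
      rw [integral_finsetSum_measure (fun i _ => f.integrable _)]
      simp only [integral_dirac, ← Complex.ofReal_sum, ← Complex.ofReal_natCast,
        ← Complex.ofReal_div, Complex.ofReal_re]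
      rw [ENNReal.toReal_inv, ENNReal.toReal_natCast, div_eq_inv_mul, smul_eq_mul]
    · simp only [hQ, ContinuousMap.coe_mk]
      rw [integral_complex_ofReal, Complex.ofReal_re]
  have h3 := ProbabilityMeasure.tendsto_measure_of_null_frontier_of_tendsto' hlim
    (E := B) (by rwa [hQ])
  have h4 := (ENNReal.tendsto_toReal (measure_ne_top _ _)).comp h3
  rw [hQ] at h4
  convert! h4 using 1
  ext N
  simp only [hP, hν, Function.comp_apply, Measure.smul_apply, Measure.finsetSum_apply,
    Measure.dirac_apply' _ hm, smul_eq_mul, ENNReal.toReal_mul]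
  rw [ENNReal.toReal_inv, ENNReal.toReal_natCast]
  simp [Set.indicator_apply]

/-- **Weyl's criterion** in `𝕋^k`. -/
theorem isUniformlyDistributed_of_weyl {k : ℕ} (x : ℕ → Fin k → ℝ)
    (h : ∀ m : Fin k → ℤ, m ≠ 0 → Tendsto (fun N : ℕ =>
      (∑ n ∈ Finset.Icc 1 N, Complex.exp (↑(2 * Real.pi * ∑ i, m i * x n i) * Complex.I)) / (N : ℂ))
      atTop (𝓝 0)) :
    IsUniformlyDistributed x := by
  classical
  intro I hI
  have h1 := tendsto_card_filter_of_weyl (fun n i => (x n i : UnitAddCircle)) (fun m hm => by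
    convert h m hm using 5 with N n
    simp only [UnitAddTorus.mFourier, ContinuousMap.coe_mk, fourier_coe_apply, ← Complex.exp_sum]
    congr 1
    push_cast
    rw [Finset.mul_sum, Finset.sum_mul]
    exact Finset.sum_congr rfl fun i _ => by ring) (Set.univ.pi fun i => circleSet (I i))
    (MeasurableSet.univ_pi fun i => measurable_coe_equivIco (hI i).1.measurableSet)
    (volume_frontier_univ_pi fun i => volume_frontier_circleSet (hI i).1)
  have hvol : volume (Set.univ.pi fun i => circleSet (I i)) = volume (Set.univ.pi I) := by
    rw [volume_pi_pi, volume_pi_pi]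
    refine Finset.prod_congr rfl fun i _ => ?_
    rw [volume_circleSet (hI i).1.measurableSet, Set.inter_eq_left.2 (hI i).2]
  rw [hvol] at h1
  convert h1 using 6 with N n
  simp [coe_mem_circleSet]

/-! ### Oscillatory integrals and van der Corput's lemma -/

theorem norm_integral_exp_le_length (g : ℝ → ℝ) {a b : ℝ} (hab : a ≤ b) :
    ‖∫ t in a..b, Complex.exp (g t * Complex.I)‖ ≤ b - a := by
  have h := intervalIntegral.norm_integral_le_of_norm_le_const (a := a) (b := b) (C := 1)
    (f := fun t => Complex.exp (g t * Complex.I))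
    (fun t _ => (Complex.norm_exp_ofReal_mul_I _).le)
  rwa [one_mul, abs_of_nonneg (sub_nonneg.2 hab)] at h

/-- Integration by parts in `exp (i g) = (1 / g') * (g' * exp (i g))`; each boundary term is at most
`1 / ρ`. -/
theorem norm_integral_exp_le_of_deriv {g : ℝ → ℝ} (hg : ContDiff ℝ 2 g) {a b ρ : ℝ} (hab : a ≤ b)
    (hρ : 0 < ρ) (h1 : ∀ t ∈ Set.Icc a b, ρ ≤ |deriv g t|) :
    ‖∫ t in a..b, Complex.exp (g t * Complex.I)‖ ≤
      2 / ρ + ∫ t in a..b, |deriv (deriv g) t| / deriv g t ^ 2 := by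
  have hd1 : ContDiff ℝ 1 (deriv g) := hg.deriv'
  have hc2 : Continuous (deriv (deriv g)) := hd1.continuous_deriv le_rfl
  have hne : ∀ t ∈ Set.uIcc a b, deriv g t ≠ 0 := fun t ht => by
    rw [Set.uIcc_of_le hab] at ht
    exact abs_pos.1 (hρ.trans_le (h1 t ht))
  set u : ℝ → ℂ := fun t => (((deriv g t)⁻¹ : ℝ) : ℂ) with hu
  set u' : ℝ → ℂ := fun t => ((-(deriv (deriv g) t) / deriv g t ^ 2 : ℝ) : ℂ) with hu'
  set v : ℝ → ℂ := fun t => -Complex.I * Complex.exp (g t * Complex.I) with hv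
  set v' : ℝ → ℂ := fun t => (deriv g t : ℝ) * Complex.exp (g t * Complex.I) with hv'
  have hud : ∀ t ∈ Set.uIcc a b, HasDerivAt u (u' t) t := fun t ht =>
    ((hd1.differentiable one_ne_zero t).hasDerivAt.inv (hne t ht)).ofReal_comp
  have hvd : ∀ t ∈ Set.uIcc a b, HasDerivAt v (v' t) t := fun t _ => by
    have h := ((((hg.differentiable two_ne_zero t).hasDerivAt.ofReal_comp).mul_const
      Complex.I).cexp).const_mul (-Complex.I)
    refine h.congr_deriv ?_
    simp only [hv']
    linear_combination (-(deriv g t : ℝ) * Complex.exp (g t * Complex.I)) * Complex.I_mul_I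
  have hu'c : ContinuousOn (fun t => -(deriv (deriv g) t) / deriv g t ^ 2) (Set.uIcc a b) :=
    (hc2.neg.continuousOn).div (hd1.continuous.pow 2).continuousOn fun t ht => pow_ne_zero 2 (hne t ht)
  have hu'i : IntervalIntegrable u' volume a b :=
    (Complex.continuous_ofReal.comp_continuousOn hu'c).intervalIntegrable
  have hv'c : Continuous v' := by
    have := hd1.continuous
    have := hg.continuous
    fun_prop
  have hparts := intervalIntegral.integral_mul_deriv_eq_deriv_mul hud hvd hu'i
    (hv'c.intervalIntegrable a b)
  have heq : ∫ t in a..b, Complex.exp (g t * Complex.I) = ∫ t in a..b, u t * v' t := by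
    refine intervalIntegral.integral_congr fun t ht => ?_
    have : ((deriv g t : ℝ) : ℂ) ≠ 0 := by exact_mod_cast hne t ht
    simp only [hu, hv']
    push_cast
    field_simp
  have hvn : ∀ t, ‖v t‖ = 1 := fun t => by
    simp [hv, Complex.norm_exp_ofReal_mul_I]
  have hun : ∀ t ∈ Set.Icc a b, ‖u t‖ ≤ 1 / ρ := fun t ht => by
    simp only [hu, Complex.norm_real, norm_inv, Real.norm_eq_abs, one_div]
    exact inv_anti₀ hρ (h1 t ht)
  rw [heq, hparts]
  have hA : ‖u b * v b‖ ≤ 1 / ρ := by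
    rw [norm_mul, hvn, mul_one]; exact hun b (Set.right_mem_Icc.2 hab)
  have hB : ‖u a * v a‖ ≤ 1 / ρ := by
    rw [norm_mul, hvn, mul_one]; exact hun a (Set.left_mem_Icc.2 hab)
  have hC : ‖∫ t in a..b, u' t * v t‖ ≤ ∫ t in a..b, |deriv (deriv g) t| / deriv g t ^ 2 := by
    refine (intervalIntegral.norm_integral_le_integral_norm hab).trans_eq ?_
    refine intervalIntegral.integral_congr fun t _ => ?_
    simp only [norm_mul, hvn, mul_one, hu', Complex.norm_real, Real.norm_eq_abs, abs_div, abs_neg,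
      abs_pow, sq_abs]
  calc _ ≤ ‖u b * v b‖ + ‖u a * v a‖ + ‖∫ t in a..b, u' t * v t‖ :=
        (norm_sub_le _ _).trans (by gcongr; exact norm_sub_le _ _)
    _ ≤ _ := by
      have : 2 / ρ = 1 / ρ + 1 / ρ := by ring
      linarith

/-- For first-order decay without monotonicity of `g'`: with phase `s φ` both terms are `O(1 / s)`.
-/
theorem norm_integral_exp_le_of_deriv_of_deriv2_le {g : ℝ → ℝ} (hg : ContDiff ℝ 2 g)
    {a b ρ M : ℝ} (hab : a ≤ b) (hρ : 0 < ρ) (h1 : ∀ t ∈ Set.Icc a b, ρ ≤ |deriv g t|)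
    (h2 : ∀ t ∈ Set.Icc a b, |deriv (deriv g) t| ≤ M) :
    ‖∫ t in a..b, Complex.exp (g t * Complex.I)‖ ≤ 2 / ρ + M / ρ ^ 2 * (b - a) := by
  refine (norm_integral_exp_le_of_deriv hg hab hρ h1).trans ?_
  gcongr
  have h := intervalIntegral.norm_integral_le_of_norm_le_const (a := a) (b := b) (C := M / ρ ^ 2)
    (f := fun t => |deriv (deriv g) t| / deriv g t ^ 2) (fun t ht => by
      rw [Set.uIoc_of_le hab] at ht
      have ht' := Set.Ioc_subset_Icc_self ht
      rw [Real.norm_eq_abs, abs_div, abs_abs, abs_pow]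
      have := h1 t ht'
      have hM := h2 t ht'
      have := (abs_nonneg _).trans hM
      gcongr)
  rw [abs_of_nonneg (sub_nonneg.2 hab)] at h
  exact (le_abs_self _).trans h

/-- When `g''` keeps its sign, `|g''| / g' ^ 2` is up to sign the derivative of `1 / g'`, so its
integral is at most `2 / ρ`, whatever the length of the interval. -/
theorem norm_integral_exp_le_of_deriv_of_monotone {g : ℝ → ℝ} (hg : ContDiff ℝ 2 g)
    {a b ρ : ℝ} (hab : a ≤ b) (hρ : 0 < ρ) (h1 : ∀ t ∈ Set.Icc a b, ρ ≤ |deriv g t|)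
    (h2 : (∀ t ∈ Set.Icc a b, 0 ≤ deriv (deriv g) t) ∨ ∀ t ∈ Set.Icc a b, deriv (deriv g) t ≤ 0) :
    ‖∫ t in a..b, Complex.exp (g t * Complex.I)‖ ≤ 4 / ρ := by
  refine (norm_integral_exp_le_of_deriv hg hab hρ h1).trans ?_
  have hd1 : ContDiff ℝ 1 (deriv g) := hg.deriv'
  have hc2 : Continuous (deriv (deriv g)) := hd1.continuous_deriv le_rfl
  have hne : ∀ t ∈ Set.uIcc a b, deriv g t ≠ 0 := fun t ht => by
    rw [Set.uIcc_of_le hab] at ht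
    exact abs_pos.1 (hρ.trans_le (h1 t ht))
  have hFTC : ∫ t in a..b, -(deriv (deriv g) t) / deriv g t ^ 2 = (deriv g b)⁻¹ - (deriv g a)⁻¹ :=
    intervalIntegral.integral_eq_sub_of_hasDerivAt
      (fun t ht => (hd1.differentiable one_ne_zero t).hasDerivAt.inv (hne t ht))
      ((hc2.neg.continuousOn).div (hd1.continuous.pow 2).continuousOn
        fun t ht => pow_ne_zero 2 (hne t ht)).intervalIntegrable
  have hinv : ∀ t ∈ Set.Icc a b, |(deriv g t)⁻¹| ≤ 1 / ρ := fun t ht => by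
    rw [abs_inv, one_div]; exact inv_anti₀ hρ (h1 t ht)
  have hb := abs_le.1 (hinv b (Set.right_mem_Icc.2 hab))
  have ha := abs_le.1 (hinv a (Set.left_mem_Icc.2 hab))
  have h4 : 4 / ρ = 2 / ρ + (1 / ρ + 1 / ρ) := by ring
  rw [h4]
  gcongr
  rcases h2 with h2 | h2
  · have : ∫ t in a..b, |deriv (deriv g) t| / deriv g t ^ 2 =
        -∫ t in a..b, -(deriv (deriv g) t) / deriv g t ^ 2 := by
      rw [← intervalIntegral.integral_neg]
      refine intervalIntegral.integral_congr fun t ht => ?_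
      rw [Set.uIcc_of_le hab] at ht
      simp only [abs_of_nonneg (h2 t ht)]
      ring
    rw [this, hFTC]
    linarith [hb.1, ha.2]
  · have : ∫ t in a..b, |deriv (deriv g) t| / deriv g t ^ 2 =
        ∫ t in a..b, -(deriv (deriv g) t) / deriv g t ^ 2 := by
      refine intervalIntegral.integral_congr fun t ht => ?_
      rw [Set.uIcc_of_le hab] at ht
      simp only [abs_of_nonpos (h2 t ht)]
    rw [this, hFTC]
    linarith [hb.2, ha.1]

/-- Take for `c` a zero of `h`, or the endpoint where `h` is closest to zero if it does not change
sign. -/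
theorem exists_mul_abs_sub_le_abs {h : ℝ → ℝ} (hh : Continuous h) {a b μ : ℝ} (hab : a ≤ b)
    (hgrow : ∀ s ∈ Set.Icc a b, ∀ t ∈ Set.Icc a b, s ≤ t → μ * (t - s) ≤ h t - h s) :
    ∃ c ∈ Set.Icc a b, ∀ t ∈ Set.Icc a b, μ * |t - c| ≤ |h t| := by
  have ha := Set.left_mem_Icc.2 hab
  have hb := Set.right_mem_Icc.2 hab
  rcases le_total 0 (h a) with h0 | h0
  · refine ⟨a, ha, fun t ht => ?_⟩
    rw [abs_of_nonneg (sub_nonneg.2 ht.1)]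
    have := hgrow a ha t ht ht.1
    linarith [le_abs_self (h t)]
  rcases le_total (h b) 0 with h1 | h1
  · refine ⟨b, hb, fun t ht => ?_⟩
    rw [abs_of_nonpos (sub_nonpos.2 ht.2)]
    have := hgrow t ht b hb ht.2
    linarith [neg_le_abs (h t)]
  obtain ⟨c, hc, hc0⟩ := intermediate_value_Icc hab hh.continuousOn ⟨h0, h1⟩
  refine ⟨c, hc, fun t ht => ?_⟩
  rcases le_total c t with hct | hct
  · rw [abs_of_nonneg (sub_nonneg.2 hct)]
    have := hgrow c hc t ht hct
    linarith [le_abs_self (h t)]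
  · rw [abs_of_nonpos (sub_nonpos.2 hct)]
    have := hgrow t ht c hc hct
    linarith [neg_le_abs (h t)]

theorem forall_le_or_forall_le_neg {F : ℝ → ℝ} (hF : Continuous F) {a b μ : ℝ} (hμ : 0 < μ)
    (h : ∀ t ∈ Set.Icc a b, μ ≤ |F t|) :
    (∀ t ∈ Set.Icc a b, μ ≤ F t) ∨ ∀ t ∈ Set.Icc a b, μ ≤ -F t := by
  by_contra! hcon
  obtain ⟨⟨s, hs, hs'⟩, t, ht, ht'⟩ := hcon
  have h1 : F s ≤ 0 := by
    by_contra! h0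
    exact absurd (h s hs) (by rw [abs_of_pos h0]; exact hs'.not_ge)
  have h2 : 0 ≤ F t := by
    by_contra! h0
    exact absurd (h t ht) (by rw [abs_of_neg h0]; exact ht'.not_ge)
  obtain ⟨u, hu, hu0⟩ := isPreconnected_Icc.intermediate_value hs ht hF.continuousOn ⟨h1, h2⟩
  have := h u hu
  rw [hu0, abs_zero] at this
  linarith

theorem exists_mul_abs_sub_le_abs_of_deriv {h : ℝ → ℝ} (hh : ContDiff ℝ 1 h) {a b μ : ℝ}
    (hab : a ≤ b) (hμ : 0 < μ) (h1 : ∀ t ∈ Set.Icc a b, μ ≤ |deriv h t|) :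
    ∃ c ∈ Set.Icc a b, ∀ t ∈ Set.Icc a b, μ * |t - c| ≤ |h t| := by
  have hd := hh.differentiable one_ne_zero
  rcases forall_le_or_forall_le_neg (hh.continuous_deriv le_rfl) hμ h1 with h2 | h2
  · exact exists_mul_abs_sub_le_abs hh.continuous hab
      ((convex_Icc a b).mul_sub_le_image_sub_of_le_deriv hh.continuous.continuousOn
        hd.differentiableOn fun t ht => h2 t (interior_subset ht))
  · obtain ⟨c, hc, hct⟩ := exists_mul_abs_sub_le_abs (h := -h) (μ := μ) hh.continuous.neg hab
      ((convex_Icc a b).mul_sub_le_image_sub_of_le_deriv hh.continuous.neg.continuousOn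
        hd.neg.differentiableOn fun t ht => by
          rw [deriv.neg]; exact h2 t (interior_subset ht))
    exact ⟨c, hc, fun t ht => by simpa using hct t ht⟩

/-- If `|h'| ≥ μ` on an interval, the integral of a unimodular function there is controlled by its
integrals over the subintervals on which `|h| ≥ μ η`. -/
theorem norm_integral_exp_le_of_split {g h : ℝ → ℝ} (hg : Continuous g) (hh : ContDiff ℝ 1 h)
    {a b μ η B : ℝ} (hab : a ≤ b) (hμ : 0 < μ) (hη : 0 < η) (hB0 : 0 ≤ B)
    (h1 : ∀ t ∈ Set.Icc a b, μ ≤ |deriv h t|)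
    (hB : ∀ p q, a ≤ p → p ≤ q → q ≤ b → (∀ t ∈ Set.Icc p q, μ * η ≤ |h t|) →
      ‖∫ t in p..q, Complex.exp (g t * Complex.I)‖ ≤ B) :
    ‖∫ t in a..b, Complex.exp (g t * Complex.I)‖ ≤ 2 * η + 2 * B := by
  obtain ⟨c, hc, hct⟩ := exists_mul_abs_sub_le_abs_of_deriv hh hab hμ h1
  have hii : ∀ p q, IntervalIntegrable (fun t => Complex.exp (g t * Complex.I)) volume p q :=
    fun p q => (by fun_prop : Continuous _).intervalIntegrable p q
  -- The middle piece `[p, q]` has length at most `2 η` and is bounded trivially; on the outer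
  -- pieces `|t - c| ≥ η`.
  set p := max a (c - η) with hp
  set q := min b (c + η) with hq
  have hap : a ≤ p := le_max_left _ _
  have hpc : p ≤ c := max_le hc.1 (by linarith)
  have hcq : c ≤ q := le_min hc.2 (by linarith)
  have hqb : q ≤ b := min_le_left _ _
  rw [← intervalIntegral.integral_add_adjacent_intervals (hii a p) (hii p b),
    ← intervalIntegral.integral_add_adjacent_intervals (hii p q) (hii q b)]
  have e1 : ‖∫ t in a..p, Complex.exp (g t * Complex.I)‖ ≤ B := by
    rcases le_total (c - η) a with h | h
    · rw [hp, max_eq_left h]; simpa using hB0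
    · refine hB a p le_rfl hap (hpc.trans hc.2) fun t ht => ?_
      refine (mul_le_mul_of_nonneg_left ?_ hμ.le).trans
        (hct t ⟨ht.1, ht.2.trans (hpc.trans hc.2)⟩)
      have h3 := ht.2
      rw [hp, max_eq_right h] at h3
      rw [abs_sub_comm]
      exact le_trans (by linarith) (le_abs_self _)
  have e2 := norm_integral_exp_le_length g (hpc.trans hcq)
  have e3 : ‖∫ t in q..b, Complex.exp (g t * Complex.I)‖ ≤ B := by
    rcases le_total b (c + η) with h | h
    · rw [hq, min_eq_left h]; simpa using hB0
    · refine hB q b (hc.1.trans hcq) hqb le_rfl fun t ht => ?_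
      refine (mul_le_mul_of_nonneg_left ?_ hμ.le).trans
        (hct t ⟨(hc.1.trans hcq).trans ht.1, ht.2⟩)
      have h3 := ht.1
      rw [hq, min_eq_right h] at h3
      exact le_trans (by linarith) (le_abs_self _)
  have e4 : q - p ≤ 2 * η := by
    have := le_max_right a (c - η)
    have := min_le_right b (c + η)
    linarith
  have := norm_add_le (∫ t in a..p, Complex.exp (g t * Complex.I))
    ((∫ t in p..q, Complex.exp (g t * Complex.I)) + ∫ t in q..b, Complex.exp (g t * Complex.I))
  have := norm_add_le (∫ t in p..q, Complex.exp (g t * Complex.I)) (∫ t in q..b, Complex.exp (g t * Complex.I))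
  linarith

/-- **Van der Corput's lemma** for derivatives of order at least two. -/
theorem exists_norm_integral_exp_le_rpow (r : ℕ) :
    ∃ C : ℝ, 0 ≤ C ∧ ∀ (g : ℝ → ℝ), (∀ n : ℕ, ContDiff ℝ n g) → ∀ a b μ : ℝ, a ≤ b → 0 < μ →
      (∀ t ∈ Set.Icc a b, μ ≤ |iteratedDeriv (r + 2) g t|) →
      ‖∫ t in a..b, Complex.exp (g t * Complex.I)‖ ≤ C * μ ^ (-(1 / ((r : ℝ) + 2))) := by
  induction r with
  | zero =>
    refine ⟨10, by norm_num, fun g hg a b μ hab hμ h => ?_⟩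
    simp only [zero_add, iteratedDeriv_succ, iteratedDeriv_zero] at h
    have hg2 : ContDiff ℝ 2 g := by exact_mod_cast hg 2
    have hd1 : ContDiff ℝ 1 (deriv g) := hg2.deriv'
    have hsign := forall_le_or_forall_le_neg (hd1.continuous_deriv le_rfl) hμ h
    -- The choice `η = μ ^ (-1/2)` balances `2 η` against `2 * 4 / (μ η)`, whence `10 = 2 + 8`.
    have hη : 0 < μ ^ (-(1 / 2 : ℝ)) := Real.rpow_pos_of_pos hμ _
    have key := norm_integral_exp_le_of_split (B := 4 / (μ * μ ^ (-(1 / 2 : ℝ)))) (hg 0).continuous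
      hd1 hab hμ hη (by positivity) h (fun p q hap hpq hqb hpqh =>
        norm_integral_exp_le_of_deriv_of_monotone hg2 hpq (by positivity) hpqh
          (hsign.imp (fun hs t ht => hμ.le.trans (hs t ⟨hap.trans ht.1, ht.2.trans hqb⟩))
            (fun hs t ht => by linarith [hs t ⟨hap.trans ht.1, ht.2.trans hqb⟩])))
    have e : 1 / (μ * μ ^ (-(1 / 2 : ℝ))) = μ ^ (-(1 / 2 : ℝ)) := by
      rw [one_div, ← Real.rpow_one_add' hμ.le (by norm_num), ← Real.rpow_neg hμ.le]
      norm_num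
    have e' : 4 / (μ * μ ^ (-(1 / 2 : ℝ))) = 4 * μ ^ (-(1 / 2 : ℝ)) := by
      rw [← mul_one_div, e]
    rw [e'] at key
    norm_num at key ⊢
    linarith
  | succ r ih =>
    obtain ⟨C, hC, ih⟩ := ih
    refine ⟨2 + 2 * C, by positivity, fun g hg a b μ hab hμ h => ?_⟩
    have hd1 : ContDiff ℝ 1 (iteratedDeriv (r + 2) g) := by
      rw [iteratedDeriv_eq_iterate]
      exact_mod_cast ContDiff.iterate_deriv' 1 (r + 2) (hg _)
    -- With `η = μ ^ (-s)` the inductive bound `(μ η) ^ (-1 / (r + 2))` equals `η`.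
    set s : ℝ := 1 / ((r : ℝ) + 3) with hs
    have hη : 0 < μ ^ (-s) := Real.rpow_pos_of_pos hμ _
    have key := norm_integral_exp_le_of_split
      (B := C * (μ * μ ^ (-s)) ^ (-(1 / ((r : ℝ) + 2)))) (hg 0).continuous
      hd1 hab hμ hη (by positivity) (fun t ht => by
        rw [← iteratedDeriv_succ]; exact h t ht) (fun p q hap hpq hqb hpqh =>
        ih g hg p q _ hpq (by positivity) hpqh)
    have e : (μ * μ ^ (-s)) ^ (-(1 / ((r : ℝ) + 2))) = μ ^ (-s) := by
      have hr : (0 : ℝ) < (r : ℝ) + 3 := by positivity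
      have hs1 : 1 + -s = (r + 2) / (r + 3) := by rw [hs]; field_simp; ring
      rw [← Real.rpow_one_add' hμ.le (by rw [hs1]; positivity), ← Real.rpow_mul hμ.le, hs1, hs]
      congr 1
      field_simp
    rw [e] at key
    have e2 : -(1 / (((r + 1 : ℕ) : ℝ) + 2)) = -s := by
      rw [hs]; push_cast; ring_nf
    rw [e2]
    linarith

/-! ### Uniform decay along an analytic curve -/

theorem eq_const_of_iteratedDeriv_eq_zero {g : ℝ → ℝ} (hg : AnalyticOnNhd ℝ g Set.univ) {t₀ : ℝ}
    (h : ∀ r : ℕ, iteratedDeriv (r + 1) g t₀ = 0) (t : ℝ) : g t = g t₀ := by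
  have hh : AnalyticAt ℝ (fun t => g t - g t₀) t₀ := (hg t₀ trivial).fun_sub analyticAt_const
  have htop : analyticOrderAt (fun t => g t - g t₀) t₀ = ⊤ := by
    refine ENat.eq_top_iff_forall_ge.2 fun n => ?_
    rw [natCast_le_analyticOrderAt_iff_iteratedDeriv_eq_zero hh]
    rintro (_ | i) _
    · simp
    · have := h i
      rw [iteratedDeriv_succ'] at this ⊢
      simpa using this
  rw [analyticOrderAt_eq_top] at htop
  have := hg.eq_of_eventuallyEq (g := fun _ => g t₀) analyticOnNhd_const
    (htop.mono fun z hz => sub_eq_zero.1 hz)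
  exact congrFun this t

section Inner

variable {E : Type*} [NormedAddCommGroup E] [InnerProductSpace ℝ E]

theorem iteratedDeriv_const_inner {f : ℝ → E} (hf : ∀ n : ℕ, ContDiff ℝ n f) (c : E) (r : ℕ) :
    iteratedDeriv r (fun t => inner ℝ c (f t)) = fun t => inner ℝ c (iteratedDeriv r f t) := by
  induction r with
  | zero => simp
  | succ r ih =>
    ext t
    have hd : ContDiff ℝ 1 (iteratedDeriv r f) := by
      rw [iteratedDeriv_eq_iterate]
      exact_mod_cast ContDiff.iterate_deriv' 1 r (hf _)
    rw [iteratedDeriv_succ, ih, iteratedDeriv_succ]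
    exact ((innerSL ℝ c).hasFDerivAt.comp_hasDerivAt t
      (hd.differentiable one_ne_zero t).hasDerivAt).deriv

/-- Decay of the oscillatory integrals with phase `s ⟪c, f⟫`, `s → ∞`, on all small intervals
around `t₀`, uniformly in `c ∈ S`. -/
def UniformDecayAt (f : ℝ → E) (t₀ : ℝ) (S : Set E) : Prop :=
  ∃ η C δ : ℝ, 0 < η ∧ 0 ≤ C ∧ 0 < δ ∧ δ ≤ 1 ∧ ∀ η' : ℝ, 0 < η' → η' ≤ η → ∀ c ∈ S, ∀ s : ℝ, 1 ≤ s →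
    ‖∫ t in (t₀ - η')..(t₀ + η'), Complex.exp ((s * inner ℝ c (f t) : ℝ) * Complex.I)‖ ≤
      C * s ^ (-δ)

/-- Quantifying over all `η' ≤ η` allows a common interval, and `s ≥ 1` allows the smaller exponent.
-/
theorem UniformDecayAt.union {f : ℝ → E} {t₀ : ℝ} {S T : Set E} (hS : UniformDecayAt f t₀ S)
    (hT : UniformDecayAt f t₀ T) : UniformDecayAt f t₀ (S ∪ T) := by
  obtain ⟨η₁, C₁, δ₁, h1, h2, h3, h4, h5⟩ := hS
  obtain ⟨η₂, C₂, δ₂, k1, k2, k3, k4, k5⟩ := hT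
  refine ⟨min η₁ η₂, C₁ + C₂, min δ₁ δ₂, lt_min h1 k1, by positivity, lt_min h3 k3,
    (min_le_left _ _).trans h4, fun η' hη' hle c hc s hs => ?_⟩
  have hs0 : 0 < s := by linarith
  rcases hc with hc | hc
  · refine (h5 η' hη' (hle.trans (min_le_left _ _)) c hc s hs).trans ?_
    have := Real.rpow_le_rpow_of_exponent_le hs (neg_le_neg (min_le_left δ₁ δ₂))
    gcongr
    linarith
  · refine (k5 η' hη' (hle.trans (min_le_right _ _)) c hc s hs).trans ?_
    have := Real.rpow_le_rpow_of_exponent_le hs (neg_le_neg (min_le_right δ₁ δ₂))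
    gcongr
    linarith

/-- By joint continuity the derivative stays bounded away from zero for `(c, t)` near `(c₀, t₀)`.
Order one needs the bound `M` on the second derivative; higher orders use van der Corput. -/
theorem exists_uniformDecayAt_nhds {f : ℝ → E} (hf : ∀ n : ℕ, ContDiff ℝ n f) {t₀ : ℝ} {c₀ : E}
    {r : ℕ} (hr : inner ℝ c₀ (iteratedDeriv (r + 1) f t₀) ≠ 0) :
    ∃ U ∈ 𝓝 c₀, UniformDecayAt f t₀ U := by
  have hcont : ∀ n, Continuous (iteratedDeriv n f) := fun n => by
    rw [iteratedDeriv_eq_iterate]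
    exact (ContDiff.iterate_deriv' 0 n (hf _)).continuous
  have hF : ∀ n, Continuous fun z : E × ℝ => |inner ℝ z.1 (iteratedDeriv n f z.2)| := fun n =>
    (continuous_fst.inner ((hcont n).comp continuous_snd)).abs
  set κ := |inner ℝ c₀ (iteratedDeriv (r + 1) f t₀)| / 2 with hκ
  set M := |inner ℝ c₀ (iteratedDeriv 2 f t₀)| + 1 with hM
  have hκ0 : 0 < κ := half_pos (abs_pos.2 hr)
  have hM0 : 0 < M := by positivity
  have e1 : ∀ᶠ z : E × ℝ in 𝓝 (c₀, t₀), κ < |inner ℝ z.1 (iteratedDeriv (r + 1) f z.2)| :=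
    (hF (r + 1)).continuousAt.eventually_const_lt (half_lt_self (abs_pos.2 hr))
  have e2 : ∀ᶠ z : E × ℝ in 𝓝 (c₀, t₀), |inner ℝ z.1 (iteratedDeriv 2 f z.2)| < M :=
    (hF 2).continuousAt.eventually_lt_const (lt_add_one _)
  obtain ⟨U, hU, W, hW, hUW⟩ := mem_nhds_prod_iff.1 (e1.and e2)
  obtain ⟨η, hη, hηW⟩ := Metric.nhds_basis_closedBall.mem_iff.1 hW
  have hmain : ∀ η' : ℝ, 0 < η' → η' ≤ η → ∀ c ∈ U, ∀ s : ℝ, 1 ≤ s →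
      ∀ t ∈ Set.Icc (t₀ - η') (t₀ + η'),
        s * κ ≤ |iteratedDeriv (r + 1) (fun t => s * inner ℝ c (f t)) t| ∧
        |iteratedDeriv 2 (fun t => s * inner ℝ c (f t)) t| ≤ s * M := by
    intro η' _ hle c hc s hs t ht
    have hs0 : 0 < s := by linarith
    have htW : t ∈ W := hηW (by
      rw [Real.closedBall_eq_Icc]
      exact ⟨by linarith [ht.1], by linarith [ht.2]⟩)
    have h : κ < |inner ℝ c (iteratedDeriv (r + 1) f t)| ∧ |inner ℝ c (iteratedDeriv 2 f t)| < M :=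
      hUW (Set.mk_mem_prod hc htW)
    have hsc : ∀ n, iteratedDeriv n (fun t => s * inner ℝ c (f t)) t =
        s * inner ℝ c (iteratedDeriv n f t) := fun n => by
      rw [iteratedDeriv_const_mul_field, iteratedDeriv_const_inner hf]
    rw [hsc, hsc, abs_mul, abs_mul, abs_of_pos hs0]
    exact ⟨by gcongr; exact h.1.le, by gcongr; exact h.2.le⟩
  have hsm : ∀ (c : E) (s : ℝ) (n : ℕ), ContDiff ℝ n fun t => s * inner ℝ c (f t) := fun c s n =>
    contDiff_const.mul (contDiff_const.inner ℝ (hf n))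
  refine ⟨U, hU, ?_⟩
  rcases r with _ | r
  · refine ⟨η, 2 / κ + M / κ ^ 2 * (2 * η), 1, hη, by positivity, one_pos, le_rfl,
      fun η' hη' hle c hc s hs => ?_⟩
    have hs0 : 0 < s := by linarith
    have h := norm_integral_exp_le_of_deriv_of_deriv2_le (g := fun t => s * inner ℝ c (f t))
      (a := t₀ - η') (b := t₀ + η') (ρ := s * κ) (M := s * M)
      (by exact_mod_cast hsm c s 2) (by linarith) (by positivity)
      (fun t ht => by simpa using (hmain η' hη' hle c hc s hs t ht).1)
      (fun t ht => by simpa [iteratedDeriv_succ] using (hmain η' hη' hle c hc s hs t ht).2)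
    refine h.trans ?_
    rw [Real.rpow_neg_one]
    have : 2 / (s * κ) + s * M / (s * κ) ^ 2 * (t₀ + η' - (t₀ - η')) =
        (2 / κ + M / κ ^ 2 * (2 * η')) * s⁻¹ := by
      field_simp
      ring
    rw [this]
    gcongr
  · obtain ⟨C, hC, hvdc⟩ := exists_norm_integral_exp_le_rpow r
    refine ⟨η, C * κ ^ (-(1 / ((r : ℝ) + 2))), 1 / ((r : ℝ) + 2), hη, by positivity, by positivity,
      by rw [div_le_one (by positivity)]; linarith [(Nat.cast_nonneg r : (0 : ℝ) ≤ r)],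
      fun η' hη' hle c hc s hs => ?_⟩
    have hs0 : 0 < s := by linarith
    refine (hvdc _ (hsm c s) (t₀ - η') (t₀ + η') (s * κ) (by linarith) (by positivity)
      fun t ht => (hmain η' hη' hle c hc s hs t ht).1).trans_eq ?_
    rw [Real.mul_rpow hs0.le hκ0.le]
    ring

/-- Converts decay in the size of a vector into decay in a linear functional of it, the form used in
scattering. The factor is `K` since `K ^ δ ≤ K`. -/
theorem rpow_neg_le_mul_truncPow {δ s K x : ℝ} (hδ : 0 < δ) (hδ1 : δ ≤ 1) (hs : 1 ≤ s) (hK : 1 ≤ K)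
    (hx : |x| ≤ K * s) : s ^ (-δ) ≤ K * truncPow δ x := by
  have hs0 : 0 < s := by linarith
  have hK0 : 0 < K := by linarith
  have h1 : s ^ (-δ) ≤ K * 1 := by
    have := Real.rpow_le_one_of_one_le_of_nonpos hs (neg_nonpos.2 hδ.le)
    linarith
  unfold truncPow
  split_ifs with h0
  · exact h1
  have hx0 := abs_pos.2 h0
  rw [mul_min_of_nonneg _ _ hK0.le]
  refine le_min ?_ h1
  have h2 : |x| / K ≤ s := by rw [div_le_iff₀ hK0]; linarith
  calc s ^ (-δ) ≤ (|x| / K) ^ (-δ) :=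
        Real.rpow_le_rpow_of_nonpos (by positivity) h2 (neg_nonpos.2 hδ.le)
    _ = K ^ δ * |x| ^ (-δ) := by
        rw [Real.div_rpow hx0.le hK0.le, Real.rpow_neg hK0.le, div_inv_eq_mul, mul_comm]
    _ ≤ K * |x| ^ (-δ) := by
        gcongr
        exact (Real.rpow_le_rpow_of_exponent_le hK hδ1).trans_eq (Real.rpow_one K)

variable [FiniteDimensional ℝ E]

/-- The direction of the affine span of a curve. -/
def curveDirection (f : ℝ → E) : Submodule ℝ E := Submodule.span ℝ (Set.range fun t => f t - f 0)

/-- If all derivatives of `⟪c₀, f⟫` vanished at `t₀`, this function would be constant and `c₀`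
orthogonal to the direction space containing it, hence zero. Compactness makes the local bounds
uniform. -/
theorem uniformDecayAt_curveDirection_sphere {f : ℝ → E} (hf : AnalyticOnNhd ℝ f Set.univ) (t₀ : ℝ) :
    UniformDecayAt f t₀ (curveDirection f ∩ Metric.sphere 0 1) := by
  have hsm : ∀ n : ℕ, ContDiff ℝ n f := fun n => hf.contDiff
  have hcomp : IsCompact ((curveDirection f : Set E) ∩ Metric.sphere 0 1) :=
    (isCompact_sphere 0 1).inter_left (Submodule.closed_of_finiteDimensional _)
  refine hcomp.induction_on (p := UniformDecayAt f t₀)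
    ⟨1, 0, 1, one_pos, le_rfl, one_pos, le_rfl, by simp⟩ ?_ (fun _ _ => UniformDecayAt.union) ?_
  · rintro S T hST ⟨η, C, δ, h1, h2, h3, h4, h5⟩
    exact ⟨η, C, δ, h1, h2, h3, h4, fun η' h h' c hc => h5 η' h h' c (hST hc)⟩
  · rintro c₀ ⟨hcV, hc1⟩
    obtain ⟨r, hr⟩ : ∃ r : ℕ, inner ℝ c₀ (iteratedDeriv (r + 1) f t₀) ≠ 0 := by
      by_contra! hcon
      have hconst := eq_const_of_iteratedDeriv_eq_zero (g := fun t => inner ℝ c₀ (f t)) (t₀ := t₀)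
        (fun t _ => ((innerSL ℝ c₀).analyticAt _).comp (hf t trivial))
        (fun r => by rw [iteratedDeriv_const_inner hsm]; exact hcon r)
      have horth : c₀ ∈ (curveDirection f)ᗮ := by
        rw [curveDirection, Submodule.mem_orthogonal]
        intro u hu
        induction hu using Submodule.span_induction with
        | mem u hu =>
          obtain ⟨t, rfl⟩ := hu
          rw [real_inner_comm, inner_sub_right, hconst t, hconst 0, sub_self]
        | zero => simp
        | add u v _ _ hu hv => rw [inner_add_left, hu, hv, add_zero]
        | smul s u _ hu => rw [inner_smul_left, hu, mul_zero]
      have : c₀ = 0 := inner_self_eq_zero.1 ((Submodule.mem_orthogonal _ _).1 horth c₀ hcV)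
      simp [this] at hc1
    obtain ⟨U, hU, hdecay⟩ := exists_uniformDecayAt_nhds hsm hr
    exact ⟨U, mem_nhdsWithin_of_mem_nhds hU, hdecay⟩

theorem exists_norm_integral_exp_inner_le_truncPow {f : ℝ → E} (hf : AnalyticOnNhd ℝ f Set.univ)
    (t₀ : ℝ) {u : E} (hu : u ∈ curveDirection f) :
    ∃ η C δ : ℝ, 0 < η ∧ 0 ≤ C ∧ 0 < δ ∧ δ ≤ 1 ∧ ∀ c : E,
      ‖∫ t in (t₀ - η)..(t₀ + η), Complex.exp ((inner ℝ c (f t) : ℝ) * Complex.I)‖ ≤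
        C * truncPow δ (inner ℝ u c) := by
  obtain ⟨η, C, δ, hη, hC, hδ, hδ1, hdecay⟩ := uniformDecayAt_curveDirection_sphere hf t₀
  set V := curveDirection f with hV
  -- For the projection `c'` of `c`, `C` serves when `‖c'‖ ≥ 1` and the length `2 * η` when `‖c'‖ ≤
  -- 1`; `1 + ‖u‖` comes from Cauchy–Schwarz for `⟪u, c'⟫`.
  refine ⟨η, (C + 2 * η) * (1 + ‖u‖), δ, hη, by positivity, hδ, hδ1, fun c => ?_⟩
  set c' := V.starProjection c with hc'
  have hc'V : c' ∈ V := V.starProjection_apply_mem c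
  have hinner : ∀ v ∈ V, inner ℝ v c = inner ℝ v c' := fun v hv => by
    rw [← sub_eq_zero, ← inner_sub_right]
    exact (Submodule.mem_orthogonal _ _).1 (V.sub_starProjection_mem_orthogonal c) v hv
  obtain ⟨β, hphase⟩ : ∃ β : ℝ, ∀ t, inner ℝ c (f t) = inner ℝ c' (f t) + β := by
    refine ⟨inner ℝ c (f 0) - inner ℝ c' (f 0), fun t => ?_⟩
    have := hinner _ (Submodule.subset_span ⟨t, rfl⟩ : f t - f 0 ∈ V)
    simp only [inner_sub_left] at this
    rw [real_inner_comm, real_inner_comm _ c', real_inner_comm _ c, real_inner_comm _ c']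
    linarith
  have hnorm : ‖∫ t in (t₀ - η)..(t₀ + η), Complex.exp ((inner ℝ c (f t) : ℝ) * Complex.I)‖ =
      ‖∫ t in (t₀ - η)..(t₀ + η), Complex.exp ((inner ℝ c' (f t) : ℝ) * Complex.I)‖ := by
    simp_rw [hphase, Complex.ofReal_add, add_mul, Complex.exp_add]
    rw [intervalIntegral.integral_mul_const, norm_mul,
      Complex.norm_exp_ofReal_mul_I, mul_one]
  have hbound : ‖∫ t in (t₀ - η)..(t₀ + η), Complex.exp ((inner ℝ c (f t) : ℝ) * Complex.I)‖ ≤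
      (C + 2 * η) * (max 1 ‖c'‖) ^ (-δ) := by
    rw [hnorm]
    rcases le_total 1 ‖c'‖ with h | h
    · rw [max_eq_right h]
      have h0 : 0 < ‖c'‖ := by linarith
      have hk := hdecay η hη le_rfl (‖c'‖⁻¹ • c') ⟨V.smul_mem _ hc'V, by
        rw [mem_sphere_zero_iff_norm, norm_smul, norm_inv, norm_norm, inv_mul_cancel₀ h0.ne']⟩ ‖c'‖ h
      simp only [inner_smul_left, conj_trivial, mul_inv_cancel_left₀ h0.ne'] at hk
      refine hk.trans ?_
      gcongr
      linarith
    · rw [max_eq_left h, Real.one_rpow]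
      refine (norm_integral_exp_le_length _ (by linarith)).trans ?_
      linarith
  refine hbound.trans ?_
  rw [mul_assoc]
  gcongr
  refine rpow_neg_le_mul_truncPow hδ hδ1 (le_max_left _ _) (by linarith [norm_nonneg u]) ?_
  rw [hinner u hu]
  refine (abs_real_inner_le_norm _ _).trans ?_
  gcongr
  · linarith
  · exact le_max_right _ _

end Inner

/-! ### Almost everywhere convergence of exponential averages -/

theorem ae_tendsto_zero_of_summable_integral {α : Type*} [MeasurableSpace α] {μ : Measure α}
    {F : ℕ → α → ℝ} (hF : ∀ j, Integrable (F j) μ) (h0 : ∀ j x, 0 ≤ F j x)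
    (hs : Summable fun j => ∫ x, F j x ∂μ) :
    ∀ᵐ x ∂μ, Tendsto (fun j => F j x) atTop (𝓝 0) := by
  have hm : ∀ j, AEMeasurable (fun x => ENNReal.ofReal (F j x)) μ := fun j =>
    (hF j).aestronglyMeasurable.aemeasurable.ennreal_ofReal
  have hfin : ∫⁻ x, ∑' j, ENNReal.ofReal (F j x) ∂μ ≠ ⊤ := by
    rw [lintegral_tsum hm]
    simp_rw [← ofReal_integral_eq_lintegral_ofReal (hF _) (ae_of_all _ (h0 _))]
    rw [← ENNReal.ofReal_tsum_of_nonneg (fun j => integral_nonneg (h0 j)) hs]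
    exact ENNReal.ofReal_ne_top
  filter_upwards [ae_lt_top' (AEMeasurable.tsum hm) hfin] with x hx
  have h1 := ENNReal.tendsto_atTop_zero_of_tsum_ne_top hx.ne
  have h2 := (ENNReal.tendsto_toReal ENNReal.zero_ne_top).comp h1
  simpa [Function.comp_def, ENNReal.toReal_ofReal (h0 _ _)] using h2

/-- Expanding the square, the diagonal gives `N * (q - p)` and each pair `m < n` gives twice a real
part. -/
theorem integral_norm_sum_exp_sq_le {ψ : ℕ → ℝ → ℝ} (hψ : ∀ n, Continuous (ψ n)) {p q : ℝ}
    {T : ℕ → ℕ → ℝ}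
    (hT : ∀ n m, ‖∫ t in p..q, Complex.exp ((ψ n t - ψ m t : ℝ) * Complex.I)‖ ≤ T n m) (N : ℕ) :
    ∫ t in p..q, ‖∑ n ∈ Finset.Icc 1 N, Complex.exp (ψ n t * Complex.I)‖ ^ 2 ≤
      N * (q - p) + 2 * ∑ n ∈ Finset.Icc 1 N, ∑ m ∈ Finset.Ico 1 n, T n m := by
  induction N with
  | zero => simp
  | succ N ih =>
    have hpt : ∀ t, ‖∑ n ∈ Finset.Icc 1 (N + 1), Complex.exp (ψ n t * Complex.I)‖ ^ 2 =
        ‖∑ n ∈ Finset.Icc 1 N, Complex.exp (ψ n t * Complex.I)‖ ^ 2 + 1 +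
        2 * ∑ m ∈ Finset.Icc 1 N, (Complex.exp ((ψ (N + 1) t - ψ m t : ℝ) * Complex.I)).re := by
      intro t
      rw [Finset.sum_Icc_succ_top (by omega), norm_add_sq_real, Complex.norm_exp_ofReal_mul_I,
        sum_inner]
      have : ∀ m, inner ℝ (Complex.exp (ψ m t * Complex.I)) (Complex.exp (ψ (N + 1) t * Complex.I)) =
          (Complex.exp ((ψ (N + 1) t - ψ m t : ℝ) * Complex.I)).re := fun m => by
        rw [Complex.inner, ← Complex.exp_conj, ← Complex.exp_add]
        congr 2
        simp
        ring
      simp_rw [this]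
      ring
    have hcre : ∀ m, Continuous fun t =>
        (Complex.exp ((ψ (N + 1) t - ψ m t : ℝ) * Complex.I)).re := fun m => by
      have := hψ m
      have := hψ (N + 1)
      fun_prop
    have hc1 : Continuous fun t => ‖∑ n ∈ Finset.Icc 1 N, Complex.exp (ψ n t * Complex.I)‖ ^ 2 := by
      fun_prop
    have hc3 : Continuous fun t =>
        ‖∑ n ∈ Finset.Icc 1 N, Complex.exp (ψ n t * Complex.I)‖ ^ 2 + 1 := hc1.add continuous_const
    have hc2 : Continuous fun t => 2 * ∑ m ∈ Finset.Icc 1 N,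
        (Complex.exp ((ψ (N + 1) t - ψ m t : ℝ) * Complex.I)).re :=
      continuous_const.mul (continuous_finsetSum _ fun m _ => hcre m)
    simp_rw [hpt]
    rw [intervalIntegral.integral_add (hc3.intervalIntegrable _ _)
        (hc2.intervalIntegrable _ _),
      intervalIntegral.integral_add (hc1.intervalIntegrable _ _)
        (continuous_const.intervalIntegrable _ _), intervalIntegral.integral_const_mul,
      intervalIntegral.integral_finsetSum fun m _ => (hcre m).intervalIntegrable _ _,
      Finset.sum_Icc_succ_top (by omega), intervalIntegral.integral_const]
    have hre : ∀ m, ∫ t in p..q, (Complex.exp ((ψ (N + 1) t - ψ m t : ℝ) * Complex.I)).re ≤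
        T (N + 1) m := fun m => by
      have hci : IntervalIntegrable
          (fun t => Complex.exp ((ψ (N + 1) t - ψ m t : ℝ) * Complex.I)) volume p q := by
        have := hψ m
        have := hψ (N + 1)
        exact (by fun_prop : Continuous _).intervalIntegrable _ _
      have h := Complex.reCLM.intervalIntegral_comp_comm hci
      simp only [Complex.reCLM_apply] at h
      rw [h]
      exact (Complex.re_le_norm _).trans (hT _ _)
    have hsum := Finset.sum_le_sum fun m (_ : m ∈ Finset.Icc 1 N) => hre m
    have hIco : Finset.Ico 1 (N + 1) = Finset.Icc 1 N := rfl
    rw [hIco]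
    simp only [smul_eq_mul, mul_one, Nat.cast_add, Nat.cast_one]
    linarith

theorem summable_inv_floor_pow {c : ℝ} (hc : 1 < c) :
    Summable fun j : ℕ => 1 / (⌊c ^ j⌋₊ : ℝ) := by
  have hc0 : 0 < c := by linarith
  have h1 : 0 < 1 - c⁻¹ := sub_pos.2 (inv_lt_one_of_one_lt₀ hc)
  refine Summable.of_nonneg_of_le (fun j => by positivity) (fun j => ?_)
    ((summable_geometric_of_lt_one (inv_nonneg.2 hc0.le) (inv_lt_one_of_one_lt₀ hc)).mul_left
      (1 - c⁻¹)⁻¹)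
  rw [inv_pow, ← mul_inv, one_div]
  exact inv_anti₀ (by positivity) (mul_pow_le_nat_floor_pow hc j)

/-- The logarithm of `⌊c ^ j⌋` is eventually at least `j * (log c / 2)`, so the series is dominated
by one in `j ^ (-(1 + ε))`. -/
theorem summable_one_div_log_floor_pow {c ε : ℝ} (hc : 1 < c) (hε : 0 < ε) :
    Summable fun j : ℕ => 1 / Real.log (⌊c ^ j⌋₊ : ℝ) ^ (1 + ε) := by
  have hc0 : 0 < c := by linarith
  have h1 : 0 < 1 - c⁻¹ := sub_pos.2 (inv_lt_one_of_one_lt₀ hc)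
  have hlc : 0 < Real.log c := Real.log_pos hc
  refine Summable.of_norm_bounded_eventually_nat
    (g := fun j : ℕ => ((Real.log c / 2) ^ (1 + ε))⁻¹ * (1 / (j : ℝ) ^ (1 + ε)))
    ((Real.summable_one_div_nat_rpow.2 (by linarith)).mul_left _) ?_
  have hlarge : ∀ᶠ j : ℕ in atTop, -Real.log (1 - c⁻¹) ≤ j * (Real.log c / 2) :=
    (tendsto_natCast_atTop_atTop.atTop_mul_const (half_pos hlc)).eventually_ge_atTop _
  filter_upwards [hlarge, eventually_gt_atTop 0] with j hj hj0
  have hj0' : (0 : ℝ) < j := by exact_mod_cast hj0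
  have hlog : (j : ℝ) * (Real.log c / 2) ≤ Real.log (⌊c ^ j⌋₊ : ℝ) := by
    have h2 := Real.log_le_log (by positivity) (mul_pow_le_nat_floor_pow hc j)
    rw [Real.log_mul h1.ne' (by positivity), Real.log_pow] at h2
    linarith
  have hlog0 : 0 ≤ Real.log (⌊c ^ j⌋₊ : ℝ) := le_trans (by positivity) hlog
  rw [Real.norm_of_nonneg (by positivity), ← one_div, one_div_mul_one_div,
    ← Real.mul_rpow (by positivity) (by positivity), mul_comm (Real.log c / 2)]
  gcongr

theorem tendsto_average_of_tendsto_floor_pow {z : ℕ → ℂ} (hz : ∀ n, ‖z n‖ ≤ 1) {c : ℕ → ℝ}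
    (cone : ∀ k, 1 < c k) (clim : Tendsto c atTop (𝓝 1))
    (h : ∀ k, Tendsto (fun j : ℕ => (∑ n ∈ Finset.Icc 1 ⌊c k ^ j⌋₊, z n) / (⌊c k ^ j⌋₊ : ℂ))
      atTop (𝓝 0)) :
    Tendsto (fun N : ℕ => (∑ n ∈ Finset.Icc 1 N, z n) / (N : ℂ)) atTop (𝓝 0) := by
  have key : ∀ x : ℕ → ℝ, (∀ n, |x n| ≤ 1) →
      (∀ k, Tendsto (fun j : ℕ => (∑ n ∈ Finset.Icc 1 ⌊c k ^ j⌋₊, x n) / (⌊c k ^ j⌋₊ : ℝ))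
        atTop (𝓝 0)) →
      Tendsto (fun N : ℕ => (∑ n ∈ Finset.Icc 1 N, x n) / (N : ℝ)) atTop (𝓝 0) := by
    intro x hx hk
    -- Adding `N` makes the partial sums monotone, so that convergence along `⌊c ^ j⌋` for ratios
    -- `c` tending to `1` gives full convergence.
    have hmono : Monotone fun N : ℕ => (N : ℝ) + ∑ n ∈ Finset.Icc 1 N, x n :=
      monotone_nat_of_le_succ fun N => by
        rw [Finset.sum_Icc_succ_top (by omega)]
        push_cast
        linarith [(abs_le.1 (hx (N + 1))).1]
    have hfl := tendsto_div_of_monotone_of_tendsto_div_floor_pow _ 1 hmono c cone clim fun k => by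
      have h1 := (hk k).const_add 1
      rw [add_zero] at h1
      refine h1.congr fun j => ?_
      have : (⌊c k ^ j⌋₊ : ℝ) ≠ 0 := by
        have := Nat.floor_pos.2 (one_le_pow₀ (cone k).le : 1 ≤ c k ^ j)
        positivity
      field_simp
    have h2 := hfl.sub_const 1
    rw [sub_self] at h2
    refine h2.congr' ?_
    filter_upwards [eventually_ne_atTop 0] with N hN
    have : (N : ℝ) ≠ 0 := by exact_mod_cast hN
    field_simp
    ring
  have hdiv : ∀ N : ℕ, (∑ n ∈ Finset.Icc 1 N, z n) / (N : ℂ) =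
      (((∑ n ∈ Finset.Icc 1 N, (z n).re) / N : ℝ) : ℂ) +
      (((∑ n ∈ Finset.Icc 1 N, (z n).im) / N : ℝ) : ℂ) * Complex.I := fun N => by
    apply Complex.ext <;> simp
  have hre := key (fun n => (z n).re) (fun n => (Complex.abs_re_le_norm _).trans (hz n)) fun k => by
    simpa [Function.comp_def, hdiv] using (Complex.continuous_re.tendsto _).comp (h k)
  have him := key (fun n => (z n).im) (fun n => (Complex.abs_im_le_norm _).trans (hz n)) fun k => by
    simpa [Function.comp_def, hdiv] using (Complex.continuous_im.tendsto _).comp (h k)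
  simp_rw [hdiv]
  have h1 := ((Complex.continuous_ofReal.tendsto _).comp hre).add
    (((Complex.continuous_ofReal.tendsto _).comp him).mul_const Complex.I)
  simpa [Function.comp_def] using h1

/-- A Davenport–Erdős–LeVeque type criterion. -/
theorem ae_tendsto_average_exp {ψ : ℕ → ℝ → ℝ} (hψ : ∀ n, Continuous (ψ n)) {p q : ℝ}
    (hpq : p ≤ q) {b : ℕ → ℝ} {C δ : ℝ} (hC : 0 ≤ C) (hb : IsDeltaScattered δ b)
    (h : ∀ n m, ‖∫ t in p..q, Complex.exp ((ψ n t - ψ m t : ℝ) * Complex.I)‖ ≤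
      C * truncPow δ (b n - b m)) :
    ∀ᵐ t ∂(volume.restrict (Set.Ioc p q)), Tendsto
      (fun N : ℕ => (∑ n ∈ Finset.Icc 1 N, Complex.exp (ψ n t * Complex.I)) / (N : ℂ))
      atTop (𝓝 0) := by
  obtain ⟨ε, hε, hbN⟩ := hb
  have hcont : ∀ N : ℕ, Continuous fun t =>
      ‖(∑ n ∈ Finset.Icc 1 N, Complex.exp (ψ n t * Complex.I)) / (N : ℂ)‖ ^ 2 := fun N => by
    fun_prop
  have hint : ∀ N : ℕ, Integrable (fun t =>
      ‖(∑ n ∈ Finset.Icc 1 N, Complex.exp (ψ n t * Complex.I)) / (N : ℂ)‖ ^ 2)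
      (volume.restrict (Set.Ioc p q)) := fun N =>
    (hcont N).integrableOn_Ioc
  have hbound : ∀ᶠ N : ℕ in atTop, ∫ t in Set.Ioc p q,
      ‖(∑ n ∈ Finset.Icc 1 N, Complex.exp (ψ n t * Complex.I)) / (N : ℂ)‖ ^ 2 ≤
        (q - p) * (1 / (N : ℝ)) + 2 * C * (1 / Real.log N ^ (1 + ε)) := by
    filter_upwards [hbN, eventually_gt_atTop 0] with N hN hN0
    have hN0' : (0 : ℝ) < N := by exact_mod_cast hN0
    have h1 := integral_norm_sum_exp_sq_le hψ h N
    rw [← intervalIntegral.integral_of_le hpq]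
    simp_rw [norm_div, div_pow, Complex.norm_natCast]
    rw [intervalIntegral.integral_div, div_le_iff₀ (by positivity)]
    refine h1.trans ?_
    simp_rw [← Finset.mul_sum]
    rw [one_div_mul_eq_div, div_le_iff₀ (by positivity)] at hN
    have h2 := mul_le_mul_of_nonneg_left hN (by positivity : 0 ≤ 2 * C)
    have h3 : (q - p) * (1 / (N : ℝ)) * (N : ℝ) ^ 2 = N * (q - p) := by field_simp
    rw [add_mul, h3]
    linarith
  have hsub : ∀ c : ℝ, 1 < c → ∀ᵐ t ∂(volume.restrict (Set.Ioc p q)), Tendsto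
      (fun j : ℕ => (∑ n ∈ Finset.Icc 1 ⌊c ^ j⌋₊, Complex.exp (ψ n t * Complex.I)) /
        (⌊c ^ j⌋₊ : ℂ)) atTop (𝓝 0) := by
    intro c hc
    have hfloor : Tendsto (fun j : ℕ => ⌊c ^ j⌋₊) atTop atTop :=
      tendsto_nat_floor_atTop.comp (tendsto_pow_atTop_atTop_of_one_lt hc)
    have hsum := ae_tendsto_zero_of_summable_integral (fun j => hint ⌊c ^ j⌋₊)
      (fun j t => by positivity) (Summable.of_norm_bounded_eventually_nat
        (((summable_inv_floor_pow hc).mul_left (q - p)).add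
          ((summable_one_div_log_floor_pow hc hε).mul_left (2 * C))) (by
        filter_upwards [hfloor.eventually hbound] with j hj
        rwa [Real.norm_of_nonneg (integral_nonneg fun t => by positivity)]))
    filter_upwards [hsum] with t ht
    rw [tendsto_zero_iff_norm_tendsto_zero]
    have := ht.sqrt
    simpa only [Real.sqrt_sq (norm_nonneg _), Real.sqrt_zero] using this
  -- Countably many ratios keep the exceptional set null.
  have hall := ae_all_iff.2 fun k : ℕ => hsub (1 + 1 / ((k : ℝ) + 1))
    (by have : 0 < 1 / ((k : ℝ) + 1) := by positivity
        linarith)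
  filter_upwards [hall] with t ht
  refine tendsto_average_of_tendsto_floor_pow (fun n => (Complex.norm_exp_ofReal_mul_I _).le)
    (c := fun k : ℕ => 1 + 1 / ((k : ℝ) + 1))
    (fun k => by have : 0 < 1 / ((k : ℝ) + 1) := by positivity
                 linarith) ?_ ht
  simpa using tendsto_one_div_add_atTop_nhds_zero_nat.const_add (1 : ℝ)

/-! ### Uniform distribution for almost every parameter -/

/-- Nullity is local in `t`. The exponent `δ` depends on `t₀`, hence the need for scattering at
every `δ`. -/
theorem ae_tendsto_average_exp_inner {E : Type*} [NormedAddCommGroup E] [InnerProductSpace ℝ E]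
    [FiniteDimensional ℝ E] {f : ℝ → E} (hf : AnalyticOnNhd ℝ f Set.univ) (c : ℕ → E) {u : E}
    (hu : u ∈ curveDirection f) (hs : IsScattered fun n => inner ℝ u (c n)) :
    ∀ᵐ t : ℝ, Tendsto (fun N : ℕ =>
      (∑ n ∈ Finset.Icc 1 N, Complex.exp ((inner ℝ (c n) (f t) : ℝ) * Complex.I)) / (N : ℂ))
      atTop (𝓝 0) := by
  have hfc : Continuous f := (hf.contDiff (n := 0)).continuous
  refine measure_null_of_locally_null _ fun t₀ _ => ?_
  obtain ⟨η, C, δ, hη, hC, hδ, hδ1, hbound⟩ := exists_norm_integral_exp_inner_le_truncPow hf t₀ hu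
  have h := ae_tendsto_average_exp (ψ := fun n t => inner ℝ (c n) (f t))
    (fun n => continuous_const.inner hfc) (by linarith : t₀ - η ≤ t₀ + η) hC (hs δ hδ hδ1)
    fun n m => by simpa only [inner_sub_left, inner_sub_right] using hbound (c n - c m)
  rw [ae_restrict_iff' measurableSet_Ioc] at h
  refine ⟨_, inter_mem_nhdsWithin _ (Ioc_mem_nhds (by linarith : t₀ - η < t₀)
    (by linarith : t₀ < t₀ + η)), measure_mono_null ?_ h⟩
  rintro t ⟨ht, htI⟩ hcon
  exact ht (hcon htI)

theorem ae_isUniformlyDistributed {k : ℕ} {f : ℝ → EuclideanSpace ℝ (Fin k)}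
    (hf : AnalyticOnNhd ℝ f Set.univ) (a : Fin k → ℕ → ℝ)
    (h : ∀ m : Fin k → ℤ, m ≠ 0 → ∃ u ∈ curveDirection f,
      IsScattered fun n => ∑ i, u i * (2 * Real.pi * m i * a i n)) :
    ∀ᵐ t : ℝ, IsUniformlyDistributed fun n i => a i n * f t i := by
  have hall : ∀ᵐ t : ℝ, ∀ m : Fin k → ℤ, m ≠ 0 → Tendsto (fun N : ℕ =>
      (∑ n ∈ Finset.Icc 1 N, Complex.exp (↑(2 * Real.pi * ∑ i, m i * (a i n * f t i)) * Complex.I)) /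
        (N : ℂ)) atTop (𝓝 0) := by
    rw [ae_all_iff]
    intro m
    by_cases hm : m = 0
    · simp [hm]
    obtain ⟨u, hu, hs⟩ := h m hm
    have hae := ae_tendsto_average_exp_inner hf
      (fun n => WithLp.toLp 2 fun i => 2 * Real.pi * m i * a i n) hu (by
        simpa [PiLp.inner_apply, mul_comm] using hs)
    filter_upwards [hae] with t ht _
    convert ht using 8 with N n
    simp only [PiLp.inner_apply, Finset.mul_sum]
    refine Finset.sum_congr rfl fun i _ => ?_
    simp
    ring
  filter_upwards [hall] with t ht
  exact isUniformlyDistributed_of_weyl _ ht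

theorem exists_mem_curveDirection_of_jointlyScattered {k : ℕ} {f : ℝ → EuclideanSpace ℝ (Fin k)}
    (hf : NoConstantCoordinate (Set.range f)) {a : Fin k → ℕ → ℝ} (ha : JointlyScattered a)
    {m : Fin k → ℤ} (hm : m ≠ 0) : ∃ u ∈ curveDirection f,
      IsScattered fun n => ∑ i, u i * (2 * Real.pi * m i * a i n) := by
  obtain ⟨i, hi⟩ := Function.ne_iff.1 hm
  obtain ⟨_, ⟨t, rfl⟩, ht⟩ := Set.not_subset.1 (hf i (f 0 i))
  -- This displacement has non-zero `i`-th coordinate and `m i ≠ 0`, so the resulting combination of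
  -- the `a i` is nontrivial.
  refine ⟨f t - f 0, Submodule.subset_span ⟨t, rfl⟩, ?_⟩
  have hi' : (m i : ℝ) ≠ 0 := by exact_mod_cast hi
  have h := ha (fun i => (f t - f 0) i * (2 * Real.pi * m i)) (fun h0 => by
    have h1 := congrFun h0 i
    have h2 : f t i - f 0 i ≠ 0 := sub_ne_zero.2 ht
    simp [hi', h2, Real.pi_ne_zero] at h1)
  simpa only [mul_assoc] using h

/-- A non-zero vector orthogonal to all `f t - f 0` would be normal to a hyperplane containing the
curve. -/
theorem curveDirection_eq_top {k : ℕ} {f : ℝ → EuclideanSpace ℝ (Fin k)}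
    (hf : NonDegenerate (Set.range f)) : curveDirection f = ⊤ := by
  rw [← Submodule.orthogonal_eq_bot_iff, Submodule.eq_bot_iff]
  intro c hc
  by_contra hc0
  refine hf c (inner ℝ c (f 0)) (fun h => hc0 (by ext i; exact congrFun h i)) ?_
  rintro _ ⟨t, rfl⟩
  have h := (Submodule.mem_orthogonal' _ _).1 hc (f t - f 0) (Submodule.subset_span ⟨t, rfl⟩)
  rw [inner_sub_right, sub_eq_zero] at h
  rw [Set.mem_ofPred_eq, ← h, PiLp.inner_apply]
  simp [mul_comm]

theorem exists_mem_curveDirection_of_nonDegenerate {k : ℕ} {f : ℝ → EuclideanSpace ℝ (Fin k)}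
    (hf : NonDegenerate (Set.range f)) {a : Fin k → ℕ → ℝ} (ha : ∀ i, IsScattered (a i))
    {m : Fin k → ℤ} (hm : m ≠ 0) : ∃ u ∈ curveDirection f,
      IsScattered fun n => ∑ i, u i * (2 * Real.pi * m i * a i n) := by
  obtain ⟨i, hi⟩ := Function.ne_iff.1 hm
  have hi' : (m i : ℝ) ≠ 0 := by exact_mod_cast hi
  -- The scaling makes the sum exactly `a i n`.
  refine ⟨EuclideanSpace.single i (2 * Real.pi * m i)⁻¹, by simp [curveDirection_eq_top hf], ?_⟩
  convert ha i using 2 with n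
  rw [Finset.sum_eq_single i (fun j _ hj => by simp [hj]) (by simp)]
  have := Real.pi_ne_zero
  simp
  field_simp

/-! ### From parameter to length, and the conclusion -/

/-- A `C¹` map is locally Lipschitz, and countably many such neighbourhoods cover the line. -/
theorem hausdorffMeasure_one_image_eq_zero {E : Type*} [NormedAddCommGroup E] [NormedSpace ℝ E]
    [MeasurableSpace E] [BorelSpace E] {f : ℝ → E} (hf : ContDiff ℝ 1 f) {s : Set ℝ}
    (hs : volume s = 0) : Measure.hausdorffMeasure 1 (f '' s) = 0 := by
  choose K U hU hK using fun t : ℝ => (hf.contDiffAt (x := t)).exists_lipschitzOnWith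
  obtain ⟨T, hT, hTU⟩ := TopologicalSpace.countable_cover_nhds hU
  have hsub : f '' s ⊆ ⋃ t ∈ T, f '' (s ∩ U t) := by
    rw [← Set.image_iUnion₂, ← Set.inter_iUnion₂, hTU, Set.inter_univ]
  refine measure_mono_null hsub ((measure_biUnion_null_iff hT).2 fun t _ => ?_)
  have h := ((hK t).mono Set.inter_subset_right).hausdorffMeasure_image_le (s := s ∩ U t) zero_le_one
  rw [hausdorffMeasure_real, measure_mono_null Set.inter_subset_left hs, mul_zero] at h
  exact le_antisymm h zero_le

end CurveUD

theorem mainTheorem4 (k : ℕ) (hk : 1 ≤ k) (γ : Set (EuclideanSpace ℝ (Fin k)))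
    (hγ : CurveUD.IsAnalyticCurve γ) (a : Fin k → ℕ → ℝ)
    (ha : ∀ i, CurveUD.IsScattered (a i))
    (h : (CurveUD.JointlyScattered a ∧ CurveUD.NoConstantCoordinate γ) ∨
      CurveUD.NonDegenerate γ) :
    (∀ᵐ x ∂(Measure.hausdorffMeasure 1 : Measure (EuclideanSpace ℝ (Fin k))),
      x ∈ γ → CurveUD.IsUniformlyDistributed (fun n i => a i n * x i)) ∧
    (∀ f : ℝ → EuclideanSpace ℝ (Fin k), CurveUD.IsAnalyticParam f γ →
      ∀ᵐ t : ℝ, CurveUD.IsUniformlyDistributed (fun n i => a i n * f t i)) := by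
  have hparam : ∀ f : ℝ → EuclideanSpace ℝ (Fin k), CurveUD.IsAnalyticParam f γ →
      ∀ᵐ t : ℝ, CurveUD.IsUniformlyDistributed (fun n i => a i n * f t i) := by
    rintro f ⟨hf, rfl⟩
    refine CurveUD.ae_isUniformlyDistributed hf a fun m hm => ?_
    rcases h with ⟨hj, hc⟩ | hn
    · exact CurveUD.exists_mem_curveDirection_of_jointlyScattered hc hj hm
    · exact CurveUD.exists_mem_curveDirection_of_nonDegenerate hn ha hm
  refine ⟨?_, hparam⟩
  -- The exceptional points of the curve lie in the image of the exceptional parameters of any one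
  -- parametrization.
  obtain ⟨f, hf⟩ := hγ
  refine measure_mono_null ?_
    (CurveUD.hausdorffMeasure_one_image_eq_zero hf.1.contDiff (hparam f hf))
  intro x hx
  obtain ⟨hxγ, hxu⟩ := Classical.not_imp.1 hx
  rw [← hf.2] at hxγ
  obtain ⟨t, rfl⟩ := hxγ
  exact ⟨t, hxu, rfl⟩
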